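/- Let $n,m\ge 0$ be integers, $A\in\mathbb R^{n\times n}$, $B\in\mathbb R^{n\times m}$, and let $(w_k)_{k\ge 0}$ be i.i.d. $\mathbb R^m$-valued random vectors with zero mean and finite covariance matrix $\Sigma_w\succ 0$, such that the support of their common law contains an open ball centred at the origin. Consider $x_{k+1}=Ax_k+Bw_k$ on $\mathbb R^n$ and let $\rho(A)$ be the spectral radius of $A$. A set $G\subseteq\mathbb R^n$ is *almost surely reached* if $\mathbb P(\exists k\ge 0:\ x_k\in G)=1$ for every initial condition $x_0\in\mathbb R^n$. Let $w$ have the law of $w_0$. **V1.** A (Borel measurable) function $V:\mathbb R^n\to\mathbb R_{\ge 0}$ with $V(x)\to\infty$ as $\|x\|\to\infty$ is a *drift function* if there is a compact set $C\subseteq\mathbb R^n$ such that $\mathbb E[V(Ax+Bw)]-V(x)\le 0$ for all $x\notin C$ (in particular the expectation is finite there). **V2.** Given a drift function $V$, a (Borel measurable) function $U:\mathbb R^n\to\mathbb R$ is a *variant function* for $V$ if there are functions $H:\mathbb R_{>0}\to\mathbb R$ and $\delta,\epsilon:\mathbb R_{>0}\to\mathbb R_{>0}$ such that for all $r>0$ and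 all $x\in\mathbb R^n$: $V(x)\le r$ implies $U(x)\le H(r)$; and if $V(x)\le r$ and $U(x)>0$, then $\mathbb P\big(U(Ax+Bw)-U(x)\le-\delta(r)\big)\ge\epsilon(r)$. **Theorem.** 1. If $\rho(A)<1$, then every bounded open set $G\subseteq\mathbb R^n$ containing the origin is almost surely reached. Moreover, there is a symmetric positive definite $Q\in\mathbb R^{n\times n}$ with $A^\top QA=Q-I$ such that $V(x)=x^\top Qx$ is a drift function, and for every bounded open $G$ containing the origin there is $b>0$ such that $U(x)=x^\top Qx-b$ is a variant function for $V$ and $\{x\in\mathbb R^n: U(x)\le 0\}\subseteq G$. 2. If $\rho(A)>1$, then no bounded open set $G\subseteq\mathbb R^n$ is almost surely reached (that is, for each such $G$ there is an initial condition $x_0$ with $\mathbb P(\exists k\ge 0:\ x_k\in G)<1$), and no drift function exists. -/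

import Mathlib

open MeasureTheory ProbabilityTheory Filter

noncomputable section

namespace StochReach

/-- `ℝⁿ` with the Euclidean norm. -/
abbrev E (n : ℕ) : Type := EuclideanSpace ℝ (Fin n)

/-- The covariance matrix of a probability law on `ℝᵐ`. -/
def covMatrix {m : ℕ} (μ : Measure (E m)) : Matrix (Fin m) (Fin m) ℝ :=
  Matrix.of fun i j => covariance (fun v : E m => v i) (fun v : E m => v j) μ

/-- `w` is an i.i.d. sequence of random vectors on the probability space `(Ω, P)`, with common
law `μ`, zero mean, finite positive definite covariance matrix, and such that the support of the
law contains an open ball centred at the origin. -/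
structure IsNoise {Ω : Type*} [MeasurableSpace Ω] {m : ℕ} (P : Measure Ω)
    (μ : Measure (E m)) (w : ℕ → Ω → E m) : Prop where
  measurable : ∀ k, Measurable (w k)
  law : ∀ k, P.map (w k) = μ
  indep : iIndepFun w P
  memLp_two : MemLp (fun v : E m => v) 2 μ
  mean_zero : ∫ v, v ∂μ = 0
  cov_posDef : (covMatrix μ).PosDef
  ball_subset_support : ∃ r : ℝ, 0 < r ∧ Metric.ball (0 : E m) r ⊆ μ.support

/-- The trajectory `x (k+1) = f (x k) (w k)` started at `x₀`. -/
def trajectory {Ω : Type*} {n m : ℕ} (f : E n → E m → E n) (w : ℕ → Ω → E m) (x₀ : E n) :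
    ℕ → Ω → E n
  | 0, _ => x₀
  | k + 1, ω => f (trajectory f w x₀ k ω) (w k ω)

/-- From every initial condition the target set `G` is hit (at some time `k ≥ 0`) with
probability one. -/
def AlmostSurelyReaches {Ω : Type*} [MeasurableSpace Ω] {n m : ℕ} (P : Measure Ω)
    (f : E n → E m → E n) (w : ℕ → Ω → E m) (G : Set (E n)) : Prop :=
  ∀ x₀ : E n, P {ω | ∃ k : ℕ, trajectory f w x₀ k ω ∈ G} = 1

/-- The drift criterion `V1`: `V` is nonnegative and tends to infinity as `‖x‖ → ∞`, and outside
some compact set the expected one-step change of `V` exists and is nonpositive. -/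
structure IsDrift {n m : ℕ} (μ : Measure (E m)) (f : E n → E m → E n) (V : E n → ℝ) : Prop where
  measurable : Measurable V
  nonneg : ∀ x, 0 ≤ V x
  coercive : Tendsto V (comap (fun x : E n => ‖x‖) atTop) atTop
  drift : ∃ C : Set (E n), IsCompact C ∧ ∀ x ∈ Cᶜ,
    Integrable (fun v => V (f x v)) μ ∧ (∫ v, V (f x v) ∂μ) - V x ≤ 0

/-- The variant criterion `V2` for `U`, relative to the drift function `V`. The values of the
supporting functions `H`, `δ`, `ε` matter only at positive arguments. -/
structure IsVariant {n m : ℕ} (μ : Measure (E m)) (f : E n → E m → E n) (V U : E n → ℝ) :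
    Prop where
  isDrift : IsDrift μ f V
  measurable : Measurable U
  variant : ∃ H δ ε : ℝ → ℝ, ∀ r : ℝ, 0 < r →
    0 < δ r ∧ 0 < ε r ∧ (∀ x, V x ≤ r → U x ≤ H r) ∧
    ∀ x, V x ≤ r → 0 < U x → ε r ≤ μ.real {v | U (f x v) - U x ≤ -δ r}

/-- The linear dynamics `f(x, w) = A x + B w`. -/
def linearMap {n m : ℕ} (A : Matrix (Fin n) (Fin n) ℝ) (B : Matrix (Fin n) (Fin m) ℝ) :
    E n → E m → E n :=
  fun x v => Matrix.toEuclideanLin A x + Matrix.toEuclideanLin B v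

/-- The quadratic form `x ↦ xᵀ Q x`. -/
def quadForm {n : ℕ} (Q : Matrix (Fin n) (Fin n) ℝ) (x : E n) : ℝ :=
  x.ofLp ⬝ᵥ Q.mulVec x.ofLp

/-- The spectral radius of a real matrix: the largest modulus of its complex eigenvalues. -/
def rho {n : ℕ} (A : Matrix (Fin n) (Fin n) ℝ) : ENNReal :=
  spectralRadius ℂ (A.map (algebraMap ℝ ℂ))

end StochReach

end

/-! Stable case. By Gelfand's formula the norms of the powers of `A` are summable, so `Q = ∑ (Aᵀ) ^
k * A ^ k` converges, solves the Stein equation and dominates the identity (`exists_lyapunov`). As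
the noise has mean zero, the drift of `V(x) = xᵀQx` is `E[V(Bw)] - ‖x‖²`. Noise near zero has
positive probability and barely disturbs the decrease `‖x‖²`, which yields the variant
(`exists_noise_radius`). Reachability is proved directly, without the drift and variant functions.
First moments are bounded uniformly in time, so the state often lies in a fixed ball, from which `N`
consecutive small noises lead into `G`. If `G` were missed with probability `p > 0`, the probability
of not yet having hit `G` would drop by a fixed amount every `N` steps. Unstable case. A left
eigenvector gives a form `L` with `L(Ax) = z L(x)` and `|z| > 1`. Discounting by powers of `|z|`
makes the total noise almost surely finite, so a large `L(x₀)` outweighs it with positive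
probability and the state diverges outside any given ball (`exists_escape`). A drift function would
be a nonnegative supermartingale up to entry into `C`; by Fatou it cannot tend to infinity with
positive probability. -/

namespace StochReach

open scoped Matrix InnerProductSpace

/-! ### Summable powers and the Stein equation. -/

section Spectral

open scoped Matrix.Norms.L2Operator

/-- In a complex Banach algebra the powers of an element of spectral radius less than one are
absolutely summable. -/
theorem summable_norm_pow_of_spectralRadius_lt_one {R : Type*} [NormedRing R]
    [NormedAlgebra ℂ R] [CompleteSpace R] (a : R) (h : spectralRadius ℂ a < 1) :
    Summable fun k : ℕ => ‖a ^ k‖ := by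
  obtain ⟨r, hr, hr1⟩ := ENNReal.lt_iff_exists_nnreal_btwn.1 h
  have hr1' : (r : ℝ) < 1 := by exact_mod_cast hr1
  -- Gelfand's formula: eventually `‖a ^ k‖ ≤ r ^ k`, a comparison with a geometric series.
  have hev := (spectrum.pow_nnnorm_pow_one_div_tendsto_nhds_spectralRadius a).eventually_lt_const hr
  refine Summable.of_norm_bounded_eventually_nat
    (summable_geometric_of_lt_one r.coe_nonneg hr1') ?_
  filter_upwards [hev, eventually_gt_atTop 0] with k hk hk0
  have h1 : ((‖a ^ k‖₊ : ENNReal) ^ (1 / k : ℝ)) ^ (k : ℝ) ≤ (r : ENNReal) ^ (k : ℝ) :=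
    ENNReal.rpow_le_rpow hk.le (Nat.cast_nonneg k)
  rw [← ENNReal.rpow_mul, one_div_mul_cancel (by positivity), ENNReal.rpow_one,
    ENNReal.rpow_natCast] at h1
  rw [norm_norm]
  exact_mod_cast h1

/-- `rho` lives on the complexification, whose operator norm dominates the real one: on real vectors
both matrices act alike and the Euclidean lengths agree. -/
theorem summable_norm_toEuclideanCLM_pow {n : ℕ} (A : Matrix (Fin n) (Fin n) ℝ)
    (h : rho A < 1) :
    Summable fun k : ℕ => ‖(Matrix.toEuclideanCLM (n := Fin n) (𝕜 := ℝ) A) ^ k‖ := by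
  have h1 := summable_norm_pow_of_spectralRadius_lt_one _ h
  refine Summable.of_nonneg_of_le (fun _ => norm_nonneg _) (fun k => ?_) h1
  rw [← Matrix.map_pow, ← map_pow]
  refine ContinuousLinearMap.opNorm_le_bound _ (norm_nonneg _) fun x => ?_
  have h2 := Matrix.l2_opNorm_mulVec ((A ^ k).map (algebraMap ℝ ℂ))
    (WithLp.toLp 2 fun i => (x i : ℂ))
  have h3 : (A ^ k).map (algebraMap ℝ ℂ) *ᵥ (fun i => (x i : ℂ))
      = fun i => (((A ^ k) *ᵥ x.ofLp) i : ℂ) :=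
    ((RingHom.map_mulVec (algebraMap ℝ ℂ) (A ^ k) x.ofLp · |>.symm) |> funext)
  simp only [h3, EuclideanSpace.norm_eq, Complex.norm_real] at h2
  simp only [EuclideanSpace.norm_eq, Matrix.ofLp_toEuclideanCLM]
  refine le_of_eq_of_le ?_ h2
  simp [EuclideanSpace.equiv]

end Spectral

/-- The Lyapunov (Stein) equation `a* q a = q - 1` is solved by `∑ (a ^ k)* a ^ k`. -/
theorem exists_hasSum_star_pow_mul_pow {R : Type*} [NormedRing R] [StarRing R]
    [NormedStarGroup R] [CompleteSpace R] (a : R) (h : Summable fun k : ℕ => ‖a ^ k‖) :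
    ∃ q : R, HasSum (fun k : ℕ => star (a ^ k) * a ^ k) q ∧ star a * q * a = q - 1 := by
  have hs : Summable fun k : ℕ => star (a ^ k) * a ^ k := by
    have hb : Summable fun k : ℕ => ‖a ^ k‖ * ‖a ^ k‖ := by
      refine Summable.of_norm_bounded_eventually_nat h ?_
      filter_upwards [h.tendsto_atTop_zero.eventually_le_const one_pos] with k hk
      rw [norm_mul, norm_norm]
      exact mul_le_of_le_one_left (norm_nonneg _) hk
    refine Summable.of_norm_bounded hb fun k => ?_
    exact (norm_mul_le _ _).trans (by rw [norm_star])
  refine ⟨_, hs.hasSum, ?_⟩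
  -- Conjugating the series by `a` shifts its index by one, so only the zeroth term `1` is lost.
  have h1 := (hs.hasSum.mul_left (star a)).mul_right a
  have h2 := (hasSum_nat_add_iff' 1).2 hs.hasSum
  have h3 : (fun k : ℕ => star a * (star (a ^ k) * a ^ k) * a)
      = fun k => star (a ^ (k + 1)) * a ^ (k + 1) := by
    funext k
    rw [pow_succ, star_mul]
    simp only [mul_assoc]
  rw [h3] at h1
  simpa using h1.unique h2

/-! ### Quadratic forms and the Lyapunov matrix. -/

section Quadratic

variable {n m : ℕ}

theorem quadForm_eq_inner (Q : Matrix (Fin n) (Fin n) ℝ) (x : E n) :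
    quadForm Q x = ⟪x, Matrix.toEuclideanCLM (n := Fin n) (𝕜 := ℝ) Q x⟫_ℝ :=
  (Matrix.inner_toEuclideanCLM Q x x).symm

theorem linearMap_eq (A : Matrix (Fin n) (Fin n) ℝ) (B : Matrix (Fin n) (Fin m) ℝ) (x : E n)
    (v : E m) : linearMap A B x v = Matrix.toEuclideanCLM (n := Fin n) (𝕜 := ℝ) A x +
      LinearMap.toContinuousLinearMap (Matrix.toEuclideanLin B) v := rfl

/-- A positive definite solution of the discrete Lyapunov equation of a Schur stable matrix. -/
theorem exists_lyapunov (A : Matrix (Fin n) (Fin n) ℝ) (h : rho A < 1) :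
    ∃ Q : Matrix (Fin n) (Fin n) ℝ, Q.PosDef ∧ A.transpose * Q * A = Q - 1 ∧
      ∀ x, ‖x‖ ^ 2 ≤ quadForm Q x := by
  set Φ := Matrix.toEuclideanCLM (n := Fin n) (𝕜 := ℝ) with hΦ
  obtain ⟨q, hq, hl⟩ := exists_hasSum_star_pow_mul_pow (Φ A)
    (summable_norm_toEuclideanCLM_pow A h)
  have hquad : ∀ x, ‖x‖ ^ 2 ≤ quadForm (Φ.symm q) x := by
    intro x
    rw [quadForm_eq_inner, ← hΦ, StarAlgEquiv.apply_symm_apply]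
    have h1 : HasSum (fun k : ℕ => ⟪x, (star (Φ A ^ k) * Φ A ^ k) x⟫_ℝ) ⟪x, q x⟫_ℝ :=
      hq.mapL ((innerSL ℝ x).comp (ContinuousLinearMap.apply ℝ (E n) x))
    have h2 : ∀ k : ℕ, ⟪x, (star (Φ A ^ k) * Φ A ^ k) x⟫_ℝ = ‖(Φ A ^ k) x‖ ^ 2 := by
      intro k
      rw [ContinuousLinearMap.star_eq_adjoint, mul_apply_eq_comp,
        ContinuousLinearMap.adjoint_inner_right, real_inner_self_eq_norm_sq]
    simp only [h2] at h1
    -- The term `k = 0` is `‖x‖ ^ 2`, and all terms are squares.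
    simpa using le_hasSum h1 0 fun k _ => sq_nonneg _
  have hstar : star q = q := by
    have h1 := hq.star
    simp only [star_mul, star_star] at h1
    exact h1.unique hq
  have hΦs : ∀ M, Φ (star M) = star (Φ M) := fun M => Φ.map_star' M
  have hΦm : ∀ M N, Φ (M * N) = Φ M * Φ N := fun M N => Φ.map_mul' M N
  have hΦ1 : ∀ M, Φ (M - 1) = Φ M - 1 := fun M => by rw [map_sub, map_one]
  have hΦi : ∀ M N, Φ M = Φ N → M = N := fun M N => (EquivLike.injective Φ).eq_iff.1
  refine ⟨Φ.symm q, ?_, ?_, hquad⟩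
  · refine Matrix.PosDef.of_dotProduct_mulVec_pos ?_ fun x hx => ?_
    · change star (Φ.symm q) = _
      apply hΦi
      rw [hΦs, StarAlgEquiv.apply_symm_apply, hstar]
    · have h1 := hquad (WithLp.toLp 2 x)
      have h2 : 0 < ‖WithLp.toLp 2 x‖ ^ 2 := by
        have : WithLp.toLp 2 x ≠ 0 := by simpa using hx
        positivity
      exact h2.trans_le (by simpa [quadForm] using h1)
  · apply hΦi
    rw [← Matrix.conjTranspose_eq_transpose_of_trivial, ← Matrix.star_eq_conjTranspose]
    rw [hΦm, hΦm, hΦs, hΦ1, StarAlgEquiv.apply_symm_apply]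
    exact hl

/-- The Stein equation tested on `x`: this noiseless decrease drives both the drift and the variant
estimates. -/
theorem quadForm_lyapunov {A Q : Matrix (Fin n) (Fin n) ℝ}
    (h : A.transpose * Q * A = Q - 1) (x : E n) :
    quadForm Q (Matrix.toEuclideanCLM (n := Fin n) (𝕜 := ℝ) A x) = quadForm Q x - ‖x‖ ^ 2 := by
  have h1 : x.ofLp ⬝ᵥ (A.transpose * Q * A).mulVec x.ofLp
      = x.ofLp ⬝ᵥ (Q - 1).mulVec x.ofLp := by rw [h]
  rw [Matrix.sub_mulVec, dotProduct_sub, Matrix.one_mulVec, Matrix.mul_assoc,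
    ← Matrix.mulVec_mulVec, Matrix.dotProduct_mulVec, Matrix.vecMul_transpose,
    ← Matrix.mulVec_mulVec] at h1
  rw [quadForm, Matrix.ofLp_toEuclideanCLM, h1, quadForm, ← real_inner_self_eq_norm_sq]
  rfl

theorem continuous_quadForm (Q : Matrix (Fin n) (Fin n) ℝ) : Continuous (quadForm Q) := by
  simp only [funext (quadForm_eq_inner Q)]
  fun_prop

theorem quadForm_le (Q : Matrix (Fin n) (Fin n) ℝ) (x : E n) :
    |quadForm Q x| ≤ ‖Matrix.toEuclideanCLM (n := Fin n) (𝕜 := ℝ) Q‖ * ‖x‖ ^ 2 := by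
  rw [quadForm_eq_inner]
  refine (abs_real_inner_le_norm _ _).trans ?_
  nlinarith [(Matrix.toEuclideanCLM (n := Fin n) (𝕜 := ℝ) Q).le_opNorm x, norm_nonneg x]

theorem quadForm_add (Q : Matrix (Fin n) (Fin n) ℝ) (x y : E n) :
    quadForm Q (x + y) = quadForm Q x
      + (⟪x, Matrix.toEuclideanCLM (n := Fin n) (𝕜 := ℝ) Q y⟫_ℝ
      + ⟪Matrix.toEuclideanCLM (n := Fin n) (𝕜 := ℝ) Q x, y⟫_ℝ) + quadForm Q y := by
  simp only [quadForm_eq_inner, map_add, inner_add_left, inner_add_right]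
  rw [real_inner_comm y]
  ring

end Quadratic

/-! ### The noise, its past, and independence of the state from the next noise. -/

theorem IsNoise.isProbabilityMeasure {Ω : Type*} [MeasurableSpace Ω] {m : ℕ} {P : Measure Ω} [IsProbabilityMeasure P]
    {μ : Measure (E m)} {w : ℕ → Ω → E m} (hw : IsNoise P μ w) : IsProbabilityMeasure μ := by
  rw [← hw.law 0]
  exact Measure.isProbabilityMeasure_map (hw.measurable 0).aemeasurable

theorem IsNoise.integrable {Ω : Type*} [MeasurableSpace Ω] {m : ℕ} {P : Measure Ω} [IsProbabilityMeasure P]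
    {μ : Measure (E m)} {w : ℕ → Ω → E m} (hw : IsNoise P μ w) :
    Integrable (fun v : E m => v) μ := by
  have := hw.isProbabilityMeasure
  exact hw.memLp_two.integrable one_le_two

theorem IsNoise.lintegral_comp {Ω : Type*} [MeasurableSpace Ω] {m : ℕ} {P : Measure Ω} {μ : Measure (E m)} {w : ℕ → Ω → E m}
    (hw : IsNoise P μ w) (k : ℕ) {g : E m → ENNReal} (hg : Measurable g) :
    ∫⁻ ω, g (w k ω) ∂P = ∫⁻ v, g v ∂μ := by
  rw [← hw.law k, lintegral_map hg (hw.measurable k)]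

theorem IsNoise.measure_ball_pos {Ω : Type*} [MeasurableSpace Ω] {m : ℕ} {P : Measure Ω}
    {μ : Measure (E m)} {w : ℕ → Ω → E m} (hw : IsNoise P μ w) {η : ℝ} (hη : 0 < η) :
    0 < μ (Metric.ball 0 η) := by
  obtain ⟨r, hr, hs⟩ := hw.ball_subset_support
  exact Measure.mem_support_iff_forall _ |>.1 (hs (Metric.mem_ball_self hr)) _
    (Metric.ball_mem_nhds _ hη)

/-- The `σ`-algebra of the events determined by `w 0, …, w (k - 1)`. -/
abbrev past {Ω : Type*} {m : ℕ} (w : ℕ → Ω → E m) (k : ℕ) : MeasurableSpace Ω :=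
  ⨆ j ∈ Set.Iio k, MeasurableSpace.comap (w j) inferInstance

theorem past_mono {Ω : Type*} {m : ℕ} (w : ℕ → Ω → E m) : Monotone (past w) :=
  fun _ _ h => biSup_mono fun _ hj => lt_of_lt_of_le hj h

theorem measurable_past {Ω : Type*} {m : ℕ} (w : ℕ → Ω → E m) {j k : ℕ} (h : j < k) :
    Measurable[past w k] (w j) :=
  (comap_measurable (w j)).mono
    (le_biSup (fun j => MeasurableSpace.comap (w j) inferInstance) (Set.mem_Iio.2 h)) le_rfl

theorem past_le {Ω : Type*} [MeasurableSpace Ω] {m : ℕ} {w : ℕ → Ω → E m} (hw : ∀ k, Measurable (w k)) (k : ℕ) :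
    past w k ≤ ‹MeasurableSpace Ω› :=
  iSup₂_le fun j _ => (hw j).comap_le

theorem indep_past {Ω : Type*} [MeasurableSpace Ω] {m : ℕ} {P : Measure Ω} {w : ℕ → Ω → E m} (hm : ∀ k, Measurable (w k))
    (hi : iIndepFun w P) (k : ℕ) :
    Indep (past w k) (MeasurableSpace.comap (w k) inferInstance) P := by
  have h := indep_iSup_of_disjoint (fun j => (hm j).comap_le) hi.iIndep
    (S := Set.Iio k) (T := {k}) (by simp)
  rwa [iSup_singleton] at h

theorem measurable_trajectory_past {Ω : Type*} {n m : ℕ} {f : E n → E m → E n}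
    (hf : Measurable (Function.uncurry f)) (w : ℕ → Ω → E m) (x₀ : E n) (k : ℕ) :
    Measurable[past w k] (trajectory f w x₀ k) := by
  induction k with
  | zero => exact measurable_const
  | succ k ih =>
    exact hf.comp ((ih.mono (past_mono w k.le_succ) le_rfl).prodMk
      (measurable_past w k.lt_succ_self))

theorem measurable_trajectory {Ω : Type*} [MeasurableSpace Ω] {n m : ℕ} {f : E n → E m → E n}
    (hf : Measurable (Function.uncurry f)) {w : ℕ → Ω → E m} (hm : ∀ k, Measurable (w k))
    (x₀ : E n) (k : ℕ) : Measurable (trajectory f w x₀ k) :=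
  (measurable_trajectory_past hf w x₀ k).mono (past_le hm k) le_rfl

theorem indepFun_trajectory {Ω : Type*} [MeasurableSpace Ω] {n m : ℕ} {f : E n → E m → E n}
    (hf : Measurable (Function.uncurry f)) {P : Measure Ω} {w : ℕ → Ω → E m}
    (hm : ∀ k, Measurable (w k)) (hi : iIndepFun w P) (x₀ : E n) (k : ℕ) :
    IndepFun (trajectory f w x₀ k) (w k) P :=
  indep_of_indep_of_le_left (indep_past hm hi k) (measurable_trajectory_past hf w x₀ k).comap_le

theorem measurable_linearMap {n m : ℕ} (A : Matrix (Fin n) (Fin n) ℝ)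
    (B : Matrix (Fin n) (Fin m) ℝ) : Measurable (Function.uncurry (linearMap A B)) := by
  refine Continuous.measurable ?_
  exact ((LinearMap.continuous_of_finiteDimensional _).comp continuous_fst).add
    ((LinearMap.continuous_of_finiteDimensional _).comp continuous_snd)

/-- A supermartingale inequality: if a nonnegative function does not increase on average along
one step, then it does not increase on average along trajectories. -/
theorem lintegral_trajectory_le {Ω : Type*} [MeasurableSpace Ω] {n m : ℕ} {f : E n → E m → E n}
    (hf : Measurable (Function.uncurry f)) {P : Measure Ω} [IsProbabilityMeasure P]
    {μ : Measure (E m)} {w : ℕ → Ω → E m} (hw : IsNoise P μ w) {g : E n → ENNReal}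
    (hg : Measurable g) (h : ∀ x, ∫⁻ v, g (f x v) ∂μ ≤ g x) (x₀ : E n) (k : ℕ) :
    ∫⁻ ω, g (trajectory f w x₀ k ω) ∂P ≤ g x₀ := by
  have := hw.isProbabilityMeasure
  induction k with
  | zero => simp [trajectory]
  | succ k ih =>
    refine le_trans ?_ ih
    have hX := measurable_trajectory hf hw.measurable x₀ k
    -- The state at time `k` depends only on `w 0, …, w (k - 1)`, so its joint law with `w k` is a
    -- product and `h` can be integrated over the law of the state.
    have hpair := (indepFun_iff_map_prod_eq_prod_map_map hX.aemeasurable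
      (hw.measurable k).aemeasurable).1 (indepFun_trajectory hf hw.measurable hw.indep x₀ k)
    have hgf : Measurable fun p : E n × E m => g (f p.1 p.2) := hg.comp hf
    have : IsProbabilityMeasure (P.map (trajectory f w x₀ k)) :=
      Measure.isProbabilityMeasure_map hX.aemeasurable
    calc ∫⁻ ω, g (f (trajectory f w x₀ k ω) (w k ω)) ∂P
        = ∫⁻ p, g (f p.1 p.2) ∂(P.map fun ω => (trajectory f w x₀ k ω, w k ω)) :=
          (lintegral_map hgf (hX.prodMk (hw.measurable k))).symm
      _ = ∫⁻ x, ∫⁻ v, g (f x v) ∂μ ∂(P.map (trajectory f w x₀ k)) := by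
          rw [hpair, hw.law k, lintegral_prod _ hgf.aemeasurable]
      _ ≤ ∫⁻ x, g x ∂(P.map (trajectory f w x₀ k)) := lintegral_mono h
      _ = _ := lintegral_map hg hX

/-! ### Quadratic drift and variant functions. -/

section DriftVariant

variable {Ω : Type*} [MeasurableSpace Ω] {n m : ℕ}

/-- A solution of the Lyapunov equation defines a quadratic drift function. -/
theorem isDrift_quadForm {P : Measure Ω} [IsProbabilityMeasure P]
    {A Q : Matrix (Fin n) (Fin n) ℝ} (B : Matrix (Fin n) (Fin m) ℝ)
    {μ : Measure (E m)} {w : ℕ → Ω → E m} (hw : IsNoise P μ w)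
    (hl : A.transpose * Q * A = Q - 1) (hQ : ∀ x, ‖x‖ ^ 2 ≤ quadForm Q x) :
    IsDrift μ (linearMap A B) (quadForm Q) where
  measurable := (continuous_quadForm Q).measurable
  nonneg x := (sq_nonneg _).trans (hQ x)
  coercive := tendsto_atTop_mono hQ ((tendsto_pow_atTop two_ne_zero).comp tendsto_comap)
  drift := by
    have := hw.isProbabilityMeasure
    set S := LinearMap.toContinuousLinearMap (Matrix.toEuclideanLin B) with hS
    set 𝒬 := Matrix.toEuclideanCLM (n := Fin n) (𝕜 := ℝ) Q with h𝒬
    have hq : Integrable (fun v => quadForm Q (S v)) μ := by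
      refine ((hw.memLp_two.integrable_norm_pow two_ne_zero).const_mul
        (‖𝒬‖ * ‖S‖ ^ 2)).mono'
        ((continuous_quadForm Q).comp S.continuous).aestronglyMeasurable (.of_forall fun v => ?_)
      refine (quadForm_le Q (S v)).trans ?_
      rw [mul_assoc, ← mul_pow]
      gcongr
      exact S.le_opNorm v
    set c := ∫ v, quadForm Q (S v) ∂μ with hc
    -- The drift equals `c - ‖x‖ ^ 2`, which is nonpositive outside this ball.
    refine ⟨Metric.closedBall 0 √c, isCompact_closedBall _ _, fun x hx => ?_⟩
    have hx' : √c < ‖x‖ := by simpa using hx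
    have hcx : c ≤ ‖x‖ ^ 2 := (Real.sqrt_le_left (norm_nonneg x)).1 hx'.le
    set y := Matrix.toEuclideanCLM (n := Fin n) (𝕜 := ℝ) A x with hy
    -- The cross terms are linear in the noise, hence have mean zero.
    let l : E m →L[ℝ] ℝ := (innerSL ℝ y ∘L 𝒬 ∘L S) + (innerSL ℝ (𝒬 y)) ∘L S
    have hexp : ∀ v, quadForm Q (linearMap A B x v)
        = quadForm Q x - ‖x‖ ^ 2 + l v + quadForm Q (S v) := by
      intro v
      rw [linearMap_eq, quadForm_add, quadForm_lyapunov hl]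
      rfl
    have hli : Integrable (fun v => l v) μ := l.integrable_comp hw.integrable
    have hl0 : ∫ v, l v ∂μ = 0 := by
      rw [l.integral_comp_comm hw.integrable, hw.mean_zero, map_zero]
    have hi1 : Integrable (fun v => quadForm Q x - ‖x‖ ^ 2 + l v) μ :=
      (integrable_const _).add hli
    simp only [hexp]
    refine ⟨hi1.add hq, ?_⟩
    rw [integral_add hi1 hq, integral_add (integrable_const _) hli, hl0, ← hc]
    simp only [integral_const, probReal_univ, one_smul]
    linarith

/-- Small noise decreases a quadratic Lyapunov function by a uniform amount on the points of
a sublevel set where the function exceeds a given positive level. -/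
theorem exists_noise_radius {A Q : Matrix (Fin n) (Fin n) ℝ} (B : Matrix (Fin n) (Fin m) ℝ)
    (hl : A.transpose * Q * A = Q - 1) (hQ : ∀ x, ‖x‖ ^ 2 ≤ quadForm Q x) {b : ℝ} (hb : 0 < b) :
    ∃ δ : ℝ, 0 < δ ∧ ∀ r : ℝ, ∃ η : ℝ, 0 < η ∧ ∀ x, quadForm Q x ≤ r → b < quadForm Q x →
      ∀ v, ‖v‖ < η → quadForm Q (linearMap A B x v) - quadForm Q x ≤ -δ := by
  set S := LinearMap.toContinuousLinearMap (Matrix.toEuclideanLin B) with hS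
  set 𝒬 := Matrix.toEuclideanCLM (n := Fin n) (𝕜 := ℝ) Q with h𝒬
  set T := Matrix.toEuclideanCLM (n := Fin n) (𝕜 := ℝ) A with hT
  have hδ : 0 < b / (2 * (‖𝒬‖ + 1)) := by positivity
  -- `quadForm Q x > b` forces `‖x‖ ^ 2 ≥ 2 * δ`; the noise may give back at most `δ` of this
  -- decrease.
  refine ⟨b / (2 * (‖𝒬‖ + 1)), hδ, fun r => ?_⟩
  set δ := b / (2 * (‖𝒬‖ + 1)) with hδdef
  -- For `‖x‖ ≤ √r` and `‖v‖ ≤ 1`, the noise changes the form by at most `K * ‖v‖`.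
  set K := 2 * (‖𝒬‖ * (‖T‖ * √r) * ‖S‖) + ‖𝒬‖ * ‖S‖ ^ 2 with hK
  have hK0 : 0 ≤ K := by positivity
  refine ⟨min 1 (δ / (K + 1)), by positivity, fun x hxr hxb v hv => ?_⟩
  have hv1 : ‖v‖ ≤ 1 := (hv.trans_le (min_le_left _ _)).le
  have hv2 : K * ‖v‖ ≤ δ := by
    have h1 : ‖v‖ * (K + 1) ≤ δ :=
      (le_div_iff₀ (by positivity)).1 (hv.trans_le (min_le_right _ _)).le
    nlinarith [norm_nonneg v]
  have hxn : ‖x‖ ≤ √r := Real.le_sqrt_of_sq_le ((hQ x).trans hxr)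
  have hx2 : 2 * δ ≤ ‖x‖ ^ 2 := by
    have h1 : b ≤ ‖x‖ ^ 2 * (‖𝒬‖ + 1) := by
      nlinarith [(le_abs_self _).trans (quadForm_le Q x), sq_nonneg ‖x‖]
    have h2 : 2 * δ = b / (‖𝒬‖ + 1) := by rw [hδdef]; field_simp
    rw [h2]
    exact (div_le_iff₀ (by positivity)).2 h1
  have hTx : ‖T x‖ ≤ ‖T‖ * √r := (T.le_opNorm x).trans (by gcongr)
  have hSv : ‖S v‖ ≤ ‖S‖ * ‖v‖ := S.le_opNorm v
  have h1 : ⟪T x, 𝒬 (S v)⟫_ℝ ≤ (‖𝒬‖ * (‖T‖ * √r) * ‖S‖) * ‖v‖ := by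
    refine (real_inner_le_norm _ _).trans ?_
    calc ‖T x‖ * ‖𝒬 (S v)‖ ≤ (‖T‖ * √r) * (‖𝒬‖ * (‖S‖ * ‖v‖)) := by
          gcongr
          exact 𝒬.le_opNorm_of_le hSv
      _ = _ := by ring
  have h2 : ⟪𝒬 (T x), S v⟫_ℝ ≤ (‖𝒬‖ * (‖T‖ * √r) * ‖S‖) * ‖v‖ := by
    refine (real_inner_le_norm _ _).trans ?_
    calc ‖𝒬 (T x)‖ * ‖S v‖ ≤ (‖𝒬‖ * (‖T‖ * √r)) * (‖S‖ * ‖v‖) := by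
          gcongr
          exact 𝒬.le_opNorm_of_le hTx
      _ = _ := by ring
  have h3 : quadForm Q (S v) ≤ ‖𝒬‖ * ‖S‖ ^ 2 * ‖v‖ := by
    refine ((le_abs_self _).trans (quadForm_le Q (S v))).trans ?_
    calc ‖𝒬‖ * ‖S v‖ ^ 2 ≤ ‖𝒬‖ * (‖S‖ * ‖v‖) ^ 2 := by gcongr
      _ = ‖𝒬‖ * ‖S‖ ^ 2 * (‖v‖ * ‖v‖) := by ring
      _ ≤ ‖𝒬‖ * ‖S‖ ^ 2 * ‖v‖ := by
          gcongr
          exact mul_le_of_le_one_left (norm_nonneg v) hv1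
  rw [linearMap_eq, quadForm_add, quadForm_lyapunov hl]
  linarith

theorem isVariant_quadForm {P : Measure Ω} [IsProbabilityMeasure P]
    {A Q : Matrix (Fin n) (Fin n) ℝ} (B : Matrix (Fin n) (Fin m) ℝ)
    {μ : Measure (E m)} {w : ℕ → Ω → E m} (hw : IsNoise P μ w)
    (hl : A.transpose * Q * A = Q - 1) (hQ : ∀ x, ‖x‖ ^ 2 ≤ quadForm Q x) {b : ℝ} (hb : 0 < b) :
    IsVariant μ (linearMap A B) (quadForm Q) (fun x => quadForm Q x - b) where
  isDrift := isDrift_quadForm B hw hl hQ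
  measurable := (continuous_quadForm Q).measurable.sub_const b
  variant := by
    have := hw.isProbabilityMeasure
    obtain ⟨δ, hδ, h⟩ := exists_noise_radius B hl hQ hb
    choose η hη h using h
    refine ⟨fun r => r - b, fun _ => δ, fun r => μ.real (Metric.ball 0 (η r)), fun r _ =>
      ⟨hδ, ?_, fun x hx => sub_le_sub_right hx b, fun x hxr hx0 => ?_⟩⟩
    · exact ENNReal.toReal_pos (hw.measure_ball_pos (hη r)).ne' (measure_ne_top _ _)
    · refine measureReal_mono fun v hv => ?_
      have h1 := h r x hxr (sub_pos.1 hx0) v (by simpa using hv)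
      simpa using h1

end DriftVariant

/-! ### Almost sure reachability in the stable case. -/

section Stable

variable {Ω : Type*} [MeasurableSpace Ω] {n m : ℕ}

theorem trajectory_linearMap_eq_sum {Ω : Type*} {n m : ℕ} (A : Matrix (Fin n) (Fin n) ℝ)
    (B : Matrix (Fin n) (Fin m) ℝ) (w : ℕ → Ω → E m) (x₀ : E n) (k : ℕ) (ω : Ω) :
    trajectory (linearMap A B) w x₀ k ω = ((Matrix.toEuclideanCLM (n := Fin n) (𝕜 := ℝ) A) ^ k) x₀
      + ∑ j ∈ Finset.range k, ((Matrix.toEuclideanCLM (n := Fin n) (𝕜 := ℝ) A) ^ (k - 1 - j))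
        (LinearMap.toContinuousLinearMap (Matrix.toEuclideanLin B) (w j ω)) := by
  induction k with
  | zero => simp [trajectory]
  | succ k ih =>
    rw [trajectory, linearMap_eq, ih, map_add, map_sum, Finset.sum_range_succ, ← add_assoc]
    congr 1
    · congr 1
      · rw [pow_succ', mul_apply_eq_comp]
      · refine Finset.sum_congr rfl fun j hj => ?_
        have hj := Finset.mem_range.1 hj
        rw [show k + 1 - 1 - j = (k - 1 - j) + 1 by omega, pow_succ', mul_apply_eq_comp]
    · simp

/-- The first absolute moments of a stable linear system are bounded uniformly in time. -/
theorem exists_lintegral_trajectory_le {P : Measure Ω} [IsProbabilityMeasure P]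
    {A : Matrix (Fin n) (Fin n) ℝ} (hA : rho A < 1) (B : Matrix (Fin n) (Fin m) ℝ)
    {μ : Measure (E m)} {w : ℕ → Ω → E m} (hw : IsNoise P μ w) (x₀ : E n) :
    ∃ K : ENNReal, K ≠ ⊤ ∧ ∀ k, ∫⁻ ω, ‖trajectory (linearMap A B) w x₀ k ω‖ₑ ∂P ≤ K := by
  set S := LinearMap.toContinuousLinearMap (Matrix.toEuclideanLin B) with hS
  set T := Matrix.toEuclideanCLM (n := Fin n) (𝕜 := ℝ) A with hT
  have hM : ∑' j : ℕ, ‖T ^ j‖ₑ ≠ ⊤ := by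
    have h1 : Summable fun j : ℕ => ‖T ^ j‖₊ :=
      NNReal.summable_coe.1 (summable_norm_toEuclideanCLM_pow A hA)
    exact ENNReal.tsum_coe_ne_top_iff_summable.2 h1
  set M := ∑' j : ℕ, ‖T ^ j‖ₑ with hMdef
  have hW : ∫⁻ v, ‖v‖ₑ ∂μ ≠ ⊤ := hw.integrable.2.ne
  set W := ∫⁻ v, ‖v‖ₑ ∂μ with hWdef
  refine ⟨M * ‖x₀‖ₑ + M * (‖S‖ₑ * W), by finiteness, fun k => ?_⟩
  have hmeas : ∀ j, Measurable fun ω => ‖w j ω‖ₑ := fun j => (hw.measurable j).enorm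
  calc ∫⁻ ω, ‖trajectory (linearMap A B) w x₀ k ω‖ₑ ∂P
      ≤ ∫⁻ ω, (‖T ^ k‖ₑ * ‖x₀‖ₑ
          + ∑ j ∈ Finset.range k, ‖T ^ (k - 1 - j)‖ₑ * (‖S‖ₑ * ‖w j ω‖ₑ)) ∂P := by
        refine lintegral_mono fun ω => ?_
        rw [trajectory_linearMap_eq_sum]
        refine (enorm_add_le _ _).trans (add_le_add ((T ^ k).le_opENorm x₀)
          ((enorm_sum_le _ _).trans (Finset.sum_le_sum fun j _ => ?_)))
        exact ((T ^ (k - 1 - j)).le_opENorm _).trans (by gcongr; exact S.le_opENorm _)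
    _ = ‖T ^ k‖ₑ * ‖x₀‖ₑ + ∑ j ∈ Finset.range k, ‖T ^ (k - 1 - j)‖ₑ * (‖S‖ₑ * W) := by
        rw [lintegral_add_left measurable_const, lintegral_const, measure_univ, mul_one,
          lintegral_finsetSum _ fun j _ => ((hmeas j).const_mul _).const_mul _]
        congr 1
        refine Finset.sum_congr rfl fun j _ => ?_
        rw [lintegral_const_mul _ ((hmeas j).const_mul _), lintegral_const_mul _ (hmeas j),
          hw.lintegral_comp j measurable_enorm]
    _ ≤ M * ‖x₀‖ₑ + M * (‖S‖ₑ * W) := by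
        -- Reversing the sum turns it into a partial sum of the series `M`, which makes the bound
        -- uniform in `k`.
        rw [← Finset.sum_mul, Finset.sum_range_reflect (fun j => ‖T ^ j‖ₑ)]
        gcongr
        · exact ENNReal.le_tsum k
        · exact ENNReal.sum_le_tsum _

/-- Over a fixed time span, trajectories driven by small noise stay close to the noiseless ones. -/
theorem exists_noise_radius_norm_sub_lt {Ω : Type*} {n m : ℕ} (A : Matrix (Fin n) (Fin n) ℝ)
    (B : Matrix (Fin n) (Fin m) ℝ) (w : ℕ → Ω → E m) (x₀ : E n) (N : ℕ) {s : ℝ} (hs : 0 < s) :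
    ∃ η : ℝ, 0 < η ∧ ∀ k ω, (∀ i < N, ‖w (k + i) ω‖ < η) →
      ‖trajectory (linearMap A B) w x₀ (k + N) ω - ((Matrix.toEuclideanCLM (n := Fin n)
        (𝕜 := ℝ) A) ^ N) (trajectory (linearMap A B) w x₀ k ω)‖ < s := by
  set S := LinearMap.toContinuousLinearMap (Matrix.toEuclideanLin B) with hS
  set T := Matrix.toEuclideanCLM (n := Fin n) (𝕜 := ℝ) A with hT
  induction N generalizing s with
  | zero => exact ⟨1, one_pos, fun k ω _ => by simpa using hs⟩
  | succ N ih =>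
    -- Half of `s` covers the earlier deviation propagated by `T`, the other half the newest noise.
    obtain ⟨η, hη, h⟩ := ih (s := s / (2 * (‖T‖ + 1))) (by positivity)
    refine ⟨min η (s / (2 * (‖S‖ + 1))), by positivity, fun k ω hω => ?_⟩
    have h1 := h k ω fun i hi => (hω i (hi.trans N.lt_succ_self)).trans_le (min_le_left _ _)
    have h2 := (hω N N.lt_succ_self).trans_le (min_le_right _ _)
    rw [lt_div_iff₀ (by positivity)] at h1 h2
    have heq : trajectory (linearMap A B) w x₀ (k + (N + 1)) ω
        - (T ^ (N + 1)) (trajectory (linearMap A B) w x₀ k ω)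
        = T (trajectory (linearMap A B) w x₀ (k + N) ω
          - (T ^ N) (trajectory (linearMap A B) w x₀ k ω)) + S (w (k + N) ω) := by
      rw [← add_assoc, trajectory, linearMap_eq, pow_succ', mul_apply_eq_comp, map_sub]
      abel
    rw [heq]
    refine (norm_add_le _ _).trans_lt ?_
    have h3 := T.le_opNorm (trajectory (linearMap A B) w x₀ (k + N) ω
          - (T ^ N) (trajectory (linearMap A B) w x₀ k ω))
    have h4 := S.le_opNorm (w (k + N) ω)
    set d := ‖trajectory (linearMap A B) w x₀ (k + N) ω
          - (T ^ N) (trajectory (linearMap A B) w x₀ k ω)‖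
    have hd : 0 ≤ d := norm_nonneg _
    nlinarith [norm_nonneg (w (k + N) ω)]

/-- The next `N` noise vectors are independent of the past. -/
theorem measureReal_inter_future {P : Measure Ω} {μ : Measure (E m)} {w : ℕ → Ω → E m}
    (hw : IsNoise P μ w) {O : Set (E m)} (hO : MeasurableSet O) {k : ℕ} {D : Set Ω}
    (hD : MeasurableSet[past w k] D) (N : ℕ) :
    P.real (D ∩ {ω | ∀ i < N, w (k + i) ω ∈ O}) = P.real D * μ.real O ^ N := by
  -- Measurability with respect to the past is carried along, since independence of `w (k + N)` is
  -- applied to this very event.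
  suffices h : MeasurableSet[past w (k + N)] (D ∩ {ω | ∀ i < N, w (k + i) ω ∈ O}) ∧
      P.real (D ∩ {ω | ∀ i < N, w (k + i) ω ∈ O}) = P.real D * μ.real O ^ N from h.2
  induction N with
  | zero => simpa using hD
  | succ N ih =>
    have heq : D ∩ {ω | ∀ i < N + 1, w (k + i) ω ∈ O}
        = (D ∩ {ω | ∀ i < N, w (k + i) ω ∈ O}) ∩ w (k + N) ⁻¹' O := by
      ext ω
      simp only [Set.mem_inter_iff, Set.mem_ofPred_eq, Set.mem_preimage, Nat.lt_succ_iff_lt_or_eq,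
        or_imp, forall_and, forall_eq, and_assoc]
    rw [heq]
    refine ⟨MeasurableSet.inter (past_mono w (Nat.le_succ (k + N)) _ ih.1)
      (measurable_past w (Nat.lt_succ_self (k + N)) hO), ?_⟩
    have h1 := (Indep_iff _ _ _).1 (indep_past hw.measurable hw.indep (k + N)) _ _ ih.1 ⟨O, hO, rfl⟩
    have h2 : P (w (k + N) ⁻¹' O) = μ O := by
      rw [← hw.law (k + N), Measure.map_apply (hw.measurable _) hO]
    rw [measureReal_def, h1, h2, ENNReal.toReal_mul, ← measureReal_def, ih.2, ← measureReal_def,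
      pow_succ, mul_assoc]

/-- A stable linear system almost surely reaches every neighbourhood of the origin. -/
theorem almostSurelyReaches_of_rho_lt_one {P : Measure Ω} [IsProbabilityMeasure P]
    {A : Matrix (Fin n) (Fin n) ℝ} (hA : rho A < 1) (B : Matrix (Fin n) (Fin m) ℝ)
    {μ : Measure (E m)} {w : ℕ → Ω → E m} (hw : IsNoise P μ w) {G : Set (E n)}
    (hG : IsOpen G) (h0 : 0 ∈ G) : AlmostSurelyReaches P (linearMap A B) w G := by
  intro x₀
  have := hw.isProbabilityMeasure
  set X := trajectory (linearMap A B) w x₀ with hX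
  have hXm := measurable_trajectory_past (measurable_linearMap A B) w x₀
  let D : ℕ → Set Ω := fun k => {ω | ∀ j ≤ k, X j ω ∉ G}
  have hDm : ∀ k, MeasurableSet[past w k] (D k) := by
    intro k
    have h1 : D k = ⋂ j ∈ Set.Iic k, (X j ⁻¹' G)ᶜ := by
      ext ω
      simp [D]
    rw [h1]
    exact MeasurableSet.biInter (Set.to_countable _) fun j hj =>
      (past_mono w hj _ (hXm j hG.measurableSet)).compl
  have hDm' : ∀ k, MeasurableSet (D k) := fun k => past_le hw.measurable k _ (hDm k)
  have hcompl : {ω | ∃ k, X k ω ∈ G} = (⋂ k, D k)ᶜ := by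
    ext ω
    simp only [Set.mem_ofPred_eq, Set.mem_compl_iff, Set.mem_iInter, D, not_forall, not_not]
    exact ⟨fun ⟨k, hk⟩ => ⟨k, k, le_rfl, hk⟩, fun ⟨_, j, _, hj⟩ => ⟨j, hj⟩⟩
  rw [hcompl, prob_compl_eq_one_iff (MeasurableSet.iInter hDm')]
  by_contra hp
  have hp' : 0 < P.real (⋂ k, D k) := ENNReal.toReal_pos hp (measure_ne_top _ _)
  set p := P.real (⋂ k, D k) with hpdef
  obtain ⟨K, hK, hKle⟩ := exists_lintegral_trajectory_le hA B hw x₀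
  -- Chosen so that Markov's inequality gives `P(‖X k‖ ≥ R) ≤ p / 2`.
  set R := 2 * (K.toReal + 1) / p with hR
  have hR0 : 0 < R := by positivity
  have hfar : ∀ k, P.real {ω | R ≤ ‖X k ω‖} ≤ p / 2 := by
    intro k
    have hm : Measurable fun ω => ‖X k ω‖ₑ :=
      (measurable_trajectory (measurable_linearMap A B) hw.measurable x₀ k).enorm
    have h1 := mul_meas_ge_le_lintegral₀ (μ := P) hm.aemeasurable (ENNReal.ofReal R)
    have h2 : {ω | ENNReal.ofReal R ≤ ‖X k ω‖ₑ} = {ω | R ≤ ‖X k ω‖} := by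
      ext ω
      rw [Set.mem_ofPred_eq, ← ofReal_norm, ENNReal.ofReal_le_ofReal_iff (norm_nonneg _)]
      rfl
    rw [h2] at h1
    have h3 := ENNReal.toReal_mono hK (h1.trans (hKle k))
    rw [ENNReal.toReal_mul, ENNReal.toReal_ofReal hR0.le] at h3
    change R * P.real _ ≤ _ at h3
    have h4 : R * (p / 2) = K.toReal + 1 := by rw [hR]; field_simp
    nlinarith
  obtain ⟨s, hs, hsG⟩ := Metric.isOpen_iff.1 hG 0 h0
  obtain ⟨N, hN⟩ : ∃ N : ℕ, ‖(Matrix.toEuclideanCLM (n := Fin n) (𝕜 := ℝ) A) ^ N‖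
      < s / 2 / R :=
    ((summable_norm_toEuclideanCLM_pow A hA).tendsto_atTop_zero.eventually_lt_const
      (by positivity)).exists
  rw [lt_div_iff₀ hR0] at hN
  obtain ⟨η, hη, hclose⟩ := exists_noise_radius_norm_sub_lt A B w x₀ N (half_pos hs)
  set ε := μ.real (Metric.ball (0 : E m) η) with hε
  have hε0 : 0 < ε := ENNReal.toReal_pos (hw.measure_ball_pos hη).ne' (measure_ne_top _ _)
  -- Not having hit `G` while inside the ball of radius `R` has probability at least `p / 2`;
  -- independently, `N` small noises occur with probability `ε ^ N`, and together they put the state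
  -- in `G` at time `k + N`.
  have hstep : ∀ k, P.real (D (k + N)) + p / 2 * ε ^ N ≤ P.real (D k) := by
    intro k
    have hFm : MeasurableSet[past w k] {ω | ‖X k ω‖ < R} :=
      hXm k (isOpen_lt continuous_norm continuous_const).measurableSet
    have hF : p / 2 ≤ P.real (D k ∩ {ω | ‖X k ω‖ < R}) := by
      have h1 : p ≤ P.real ((D k ∩ {ω | ‖X k ω‖ < R}) ∪ {ω | R ≤ ‖X k ω‖}) := by
        refine measureReal_mono fun ω hω => ?_
        rcases lt_or_ge ‖X k ω‖ R with h | h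
        · exact Or.inl ⟨Set.mem_iInter.1 hω k, h⟩
        · exact Or.inr h
      linarith [measureReal_union_le (μ := P) (D k ∩ {ω | ‖X k ω‖ < R}) {ω | R ≤ ‖X k ω‖}, hfar k]
    have hind := measureReal_inter_future hw
      (Metric.isOpen_ball (x := (0 : E m)) (ε := η)).measurableSet (MeasurableSet.inter (hDm k) hFm) N
    have hdisj : Disjoint (D (k + N))
        ((D k ∩ {ω | ‖X k ω‖ < R}) ∩ {ω | ∀ i < N, w (k + i) ω ∈ Metric.ball 0 η}) := by
      refine Set.disjoint_left.2 fun ω hω hω' => hω (k + N) le_rfl (hsG ?_)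
      have h1 := hclose k ω fun i hi => by simpa using hω'.2 i hi
      have h2 := ((Matrix.toEuclideanCLM (n := Fin n) (𝕜 := ℝ) A) ^ N).le_opNorm (X k ω)
      have h3 : ‖X k ω‖ < R := hω'.1.2
      rw [mem_ball_zero_iff]
      calc ‖X (k + N) ω‖ ≤ _ := norm_le_norm_sub_add _
            (((Matrix.toEuclideanCLM (n := Fin n) (𝕜 := ℝ) A) ^ N) (X k ω))
        _ < s / 2 + s / 2 := add_lt_add_of_lt_of_le h1 (h2.trans (le_trans (by gcongr) hN.le))
        _ = s := add_halves s
    have hsub : D (k + N) ∪ ((D k ∩ {ω | ‖X k ω‖ < R})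
        ∩ {ω | ∀ i < N, w (k + i) ω ∈ Metric.ball 0 η}) ⊆ D k :=
      Set.union_subset (fun ω hω j hj => hω j (hj.trans (Nat.le_add_right k N)))
        fun ω hω => hω.1.1
    have h1 := measureReal_mono (μ := P) hsub
    rw [measureReal_union' hdisj (hDm' _), hind] at h1
    refine le_trans ?_ h1
    gcongr
  have hiter : ∀ j : ℕ, P.real (D (j * N)) + j * (p / 2 * ε ^ N) ≤ P.real (D 0) := by
    intro j
    induction j with
    | zero => simp
    | succ j ih =>
      have := hstep (j * N)
      rw [add_mul, one_mul]
      push_cast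
      linarith
  obtain ⟨j, hj⟩ := exists_nat_gt (1 / (p / 2 * ε ^ N))
  rw [div_lt_iff₀ (by positivity)] at hj
  linarith [hiter j, measureReal_le_one (μ := P) (s := D 0),
    measureReal_nonneg (μ := P) (s := D (j * N))]

end Stable

/-! ### Escape and absence of drift functions in the unstable case. -/

section Unstable

variable {Ω : Type*} [MeasurableSpace Ω] {n m : ℕ}

/-- A matrix of spectral radius greater than one has an unstable left eigenvector, viewed as
a complex linear form. -/
theorem exists_left_eigenform {A : Matrix (Fin n) (Fin n) ℝ} (hA : 1 < rho A) :
    ∃ (z : ℂ) (L : E n →L[ℝ] ℂ), 1 < ‖z‖ ∧ L ≠ 0 ∧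
      ∀ x, L (Matrix.toEuclideanCLM (n := Fin n) (𝕜 := ℝ) A x) = z * L x := by
  obtain ⟨z, hz⟩ := lt_iSup_iff.1 hA
  obtain ⟨hzs, hz1⟩ := lt_iSup_iff.1 hz
  have hz1 : 1 < ‖z‖ := by exact_mod_cast hz1
  rw [spectrum.mem_iff, Matrix.isUnit_iff_isUnit_det, isUnit_iff_ne_zero, not_not] at hzs
  obtain ⟨l, hl0, hl⟩ := Matrix.exists_vecMul_eq_zero_iff.2 hzs
  rw [Matrix.vecMul_sub, sub_eq_zero, Algebra.algebraMap_eq_smul_one, Matrix.vecMul_smul,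
    Matrix.vecMul_one] at hl
  let L₀ : E n →ₗ[ℝ] ℂ :=
    { toFun := fun x => l ⬝ᵥ fun i => (x i : ℂ)
      map_add' := fun x y => by
        rw [← dotProduct_add]
        congr 1
        ext i
        simp
      map_smul' := fun c x => by
        rw [RingHom.id_apply, Complex.real_smul, ← smul_eq_mul, ← dotProduct_smul]
        congr 1
        ext i
        simp }
  refine ⟨z, LinearMap.toContinuousLinearMap L₀, hz1, fun h => hl0 ?_, fun x => ?_⟩
  -- Real basis vectors recover every coordinate of `l`, so the form does not vanish on real space.
  · ext i
    have h1 := DFunLike.congr_fun h (EuclideanSpace.single i (1 : ℝ))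
    have h2 : (fun j => ((EuclideanSpace.single i (1 : ℝ) : E n) j : ℂ)) = Pi.single i 1 := by
      ext j
      by_cases hj : j = i
      · subst hj; simp
      · simp [hj]
    change l ⬝ᵥ (fun j => ((EuclideanSpace.single i (1 : ℝ) : E n) j : ℂ)) = 0 at h1
    rw [h2, dotProduct_single, mul_one] at h1
    exact h1
  · change l ⬝ᵥ (fun i => ((A *ᵥ x.ofLp) i : ℂ)) = z * (l ⬝ᵥ fun i => (x i : ℂ))
    have h3 : (A.map (algebraMap ℝ ℂ)) *ᵥ (fun i => (x i : ℂ))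
      = fun i => ((A *ᵥ x.ofLp) i : ℂ) :=
      ((RingHom.map_mulVec (algebraMap ℝ ℂ) A x.ofLp · |>.symm) |> funext)
    rw [← h3, Matrix.dotProduct_mulVec, ← hl, smul_dotProduct, smul_eq_mul]

/-- Dividing by `q ^ k` telescopes the recursion, leaving the start minus a discounted perturbation
to compete with. -/
theorem mul_sub_sum_le_of_mul_sub_le {q : ℝ} (hq : 0 < q) {a u : ℕ → ℝ}
    (h : ∀ k, q * a k - u k ≤ a (k + 1)) (k : ℕ) :
    q ^ k * (a 0 - ∑ j ∈ Finset.range k, u j / q ^ (j + 1)) ≤ a k := by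
  induction k with
  | zero => simp
  | succ k ih =>
    refine le_trans ?_ (h k)
    have h1 : q ^ (k + 1) * (u k / q ^ (k + 1)) = u k := by field_simp
    have h2 := mul_le_mul_of_nonneg_left ih hq.le
    rw [Finset.sum_range_succ, ← sub_sub, mul_sub, h1]
    refine sub_le_sub_right (le_of_eq_of_le ?_ h2) _
    ring

/-- Discounted sums of the noise are bounded with positive probability. -/
theorem exists_measure_discounted_noise_pos {P : Measure Ω} [IsProbabilityMeasure P]
    {μ : Measure (E m)} {w : ℕ → Ω → E m} (hw : IsNoise P μ w) (β : ℝ) {q : ℝ} (hq : 1 < q) :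
    ∃ c : ℝ, P {ω | ∀ k, ∑ j ∈ Finset.range k, β * ‖w j ω‖ / q ^ (j + 1) ≤ c} ≠ 0 := by
  have hq0 : 0 < q := zero_lt_one.trans hq
  let Z : Ω → ENNReal := fun ω =>
    ∑' j : ℕ, ENNReal.ofReal (|β| * (q⁻¹) ^ (j + 1)) * ‖w j ω‖ₑ
  have hm : ∀ j, Measurable fun ω => ‖w j ω‖ₑ := fun j => (hw.measurable j).enorm
  have hsum : Summable fun j : ℕ => |β| * (q⁻¹) ^ (j + 1) :=
    ((summable_nat_add_iff 1).2 (summable_geometric_of_lt_one (inv_nonneg.2 hq0.le)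
      (inv_lt_one_of_one_lt₀ hq))).mul_left _
  have hZ : ∫⁻ ω, Z ω ∂P ≠ ⊤ := by
    have h1 : ∫⁻ ω, Z ω ∂P
        = (∑' j : ℕ, ENNReal.ofReal (|β| * (q⁻¹) ^ (j + 1))) * ∫⁻ v, ‖v‖ₑ ∂μ := by
      rw [lintegral_tsum fun j => ((hm j).const_mul _).aemeasurable, ← ENNReal.tsum_mul_right]
      refine tsum_congr fun j => ?_
      rw [lintegral_const_mul _ (hm j), hw.lintegral_comp j measurable_enorm]
    rw [h1]
    exact ENNReal.mul_ne_top hsum.tsum_ofReal_ne_top hw.integrable.2.ne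
  have hZm : Measurable Z := Measurable.tsum fun j => (hm j).const_mul _
  have hfin := ae_lt_top hZm hZ
  -- `Z` is almost surely finite, so the events for `c ∈ ℕ` cover almost everything and cannot all
  -- be null.
  by_contra! hc
  have h0 : P (⋃ c : ℕ, {ω | ∀ k, ∑ j ∈ Finset.range k, β * ‖w j ω‖ / q ^ (j + 1) ≤ c}) = 0 :=
    measure_iUnion_null fun c => hc c
  have h1 : ∀ᵐ ω ∂P, ω ∈ ⋃ c : ℕ,
      {ω | ∀ k, ∑ j ∈ Finset.range k, β * ‖w j ω‖ / q ^ (j + 1) ≤ c} := by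
    filter_upwards [hfin] with ω hω
    obtain ⟨c, hcω⟩ := exists_nat_ge (Z ω).toReal
    refine Set.mem_iUnion.2 ⟨c, fun k => le_trans ?_ hcω⟩
    have h2 := ENNReal.toReal_mono hω.ne (ENNReal.sum_le_tsum (Finset.range k)
      (f := fun j : ℕ => ENNReal.ofReal (|β| * (q⁻¹) ^ (j + 1)) * ‖w j ω‖ₑ))
    refine le_trans ?_ h2
    rw [ENNReal.toReal_sum fun j _ => by finiteness]
    refine Finset.sum_le_sum fun j _ => ?_
    rw [ENNReal.toReal_mul, ENNReal.toReal_ofReal (by positivity), toReal_enorm, inv_pow,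
      mul_right_comm, ← div_eq_mul_inv]
    gcongr
    exact le_abs_self β
  have h2 : P (⋃ c : ℕ, {ω | ∀ k, ∑ j ∈ Finset.range k, β * ‖w j ω‖ / q ^ (j + 1) ≤ c})ᶜ = 0 :=
    h1
  have h3 := measure_union_le (μ := P) (⋃ c : ℕ, {ω | ∀ k, ∑ j ∈ Finset.range k,
    β * ‖w j ω‖ / q ^ (j + 1) ≤ c}) (⋃ c : ℕ, {ω | ∀ k, ∑ j ∈ Finset.range k,
    β * ‖w j ω‖ / q ^ (j + 1) ≤ c})ᶜ
  rw [Set.union_compl_self, h0, h2, measure_univ] at h3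
  simp at h3

/-- From suitable initial conditions, an unstable linear system stays outside a given ball and
diverges with positive probability. -/
theorem exists_escape {P : Measure Ω} [IsProbabilityMeasure P]
    {A : Matrix (Fin n) (Fin n) ℝ} (hA : 1 < rho A) (B : Matrix (Fin n) (Fin m) ℝ)
    {μ : Measure (E m)} {w : ℕ → Ω → E m} (hw : IsNoise P μ w) (R : ℝ) :
    ∃ (x₀ : E n) (F : Set Ω), P F ≠ 0 ∧ ∀ ω ∈ F,
      (∀ k, R < ‖trajectory (linearMap A B) w x₀ k ω‖) ∧
      Tendsto (fun k => ‖trajectory (linearMap A B) w x₀ k ω‖) atTop atTop := by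
  obtain ⟨z, L, hz, hL0, hL⟩ := exists_left_eigenform hA
  set S := LinearMap.toContinuousLinearMap (Matrix.toEuclideanLin B) with hS
  obtain ⟨c, hc⟩ := exists_measure_discounted_noise_pos hw ‖L ∘L S‖ hz
  have hLpos : 0 < ‖L‖ := norm_pos_iff.2 hL0
  obtain ⟨y, hy⟩ : ∃ y, L y ≠ 0 := by
    by_contra! h
    exact hL0 (ContinuousLinearMap.ext h)
  have hy' : 0 < ‖L y‖ := norm_pos_iff.2 hy
  -- Scales `y` so that `‖L x₀‖` still leaves `‖L‖ * (|R| + 1)` after paying `c` for the noise.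
  set M := (|c| + ‖L‖ * (|R| + 1)) / ‖L y‖ with hM
  have hM0 : 0 ≤ M := by positivity
  refine ⟨M • y, _, hc, fun ω hω => ?_⟩
  set X := trajectory (linearMap A B) w (M • y) with hX
  have hX0 : ‖L (X 0 ω)‖ = |c| + ‖L‖ * (|R| + 1) := by
    change ‖L (M • y)‖ = _
    rw [map_smul, norm_smul, Real.norm_of_nonneg hM0, hM]
    field_simp
  have hstep : ∀ k, ‖z‖ * ‖L (X k ω)‖ - ‖L ∘L S‖ * ‖w k ω‖ ≤ ‖L (X (k + 1) ω)‖ := by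
    intro k
    have h1 : L (X (k + 1) ω) = z * L (X k ω) + (L ∘L S) (w k ω) := by
      rw [hX, trajectory, linearMap_eq, map_add, hL]
      rfl
    rw [h1, ← norm_mul]
    have h2 := norm_sub_le_norm_add (z * L (X k ω)) ((L ∘L S) (w k ω))
    linarith [(L ∘L S).le_opNorm (w k ω)]
  have hlow : ∀ k, ‖z‖ ^ k * (|R| + 1) ≤ ‖X k ω‖ := by
    intro k
    have h1 := mul_sub_sum_le_of_mul_sub_le (zero_lt_one.trans hz) hstep k
    have h2 : ‖L‖ * (|R| + 1) ≤ ‖L (X 0 ω)‖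
        - ∑ j ∈ Finset.range k, ‖L ∘L S‖ * ‖w j ω‖ / ‖z‖ ^ (j + 1) := by
      linarith [hω k, le_abs_self c]
    have h3 : ‖L‖ * (‖z‖ ^ k * (|R| + 1)) ≤ ‖L‖ * ‖X k ω‖ := by
      refine le_trans ?_ (L.le_opNorm (X k ω))
      refine le_trans ?_ h1
      rw [mul_left_comm]
      gcongr
    exact le_of_mul_le_mul_left h3 hLpos
  refine ⟨fun k => ?_, tendsto_atTop_mono hlow
    ((tendsto_pow_atTop_atTop_of_one_lt hz).atTop_mul_const (by positivity))⟩
  have h1 : 1 * (|R| + 1) ≤ ‖z‖ ^ k * (|R| + 1) := by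
    gcongr
    exact one_le_pow₀ hz.le
  linarith [hlow k, le_abs_self R]

theorem not_almostSurelyReaches_of_one_lt_rho {P : Measure Ω} [IsProbabilityMeasure P]
    {A : Matrix (Fin n) (Fin n) ℝ} (hA : 1 < rho A) (B : Matrix (Fin n) (Fin m) ℝ)
    {μ : Measure (E m)} {w : ℕ → Ω → E m} (hw : IsNoise P μ w) {G : Set (E n)}
    (hGo : IsOpen G) (hG : Bornology.IsBounded G) :
    ¬ AlmostSurelyReaches P (linearMap A B) w G := by
  intro h
  obtain ⟨R, hR⟩ := hG.exists_norm_le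
  obtain ⟨x₀, F, hF, hFω⟩ := exists_escape hA B hw R
  have hmeas : MeasurableSet {ω | ∃ k, trajectory (linearMap A B) w x₀ k ω ∈ G} := by
    rw [Set.ofPred_exists]
    exact MeasurableSet.iUnion fun k =>
      measurable_trajectory (measurable_linearMap A B) hw.measurable x₀ k hGo.measurableSet
  have h1 := (prob_compl_eq_zero_iff hmeas).2 (h x₀)
  refine hF (measure_mono_null (fun ω hω => ?_) h1)
  rintro ⟨k, hk⟩
  exact ((hFω ω hω).1 k).not_ge (hR _ hk)

open Classical in
/-- An unstable linear system admits no drift function. -/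
theorem not_isDrift_of_one_lt_rho {P : Measure Ω} [IsProbabilityMeasure P]
    {A : Matrix (Fin n) (Fin n) ℝ} (hA : 1 < rho A) (B : Matrix (Fin n) (Fin m) ℝ)
    {μ : Measure (E m)} {w : ℕ → Ω → E m} (hw : IsNoise P μ w) (V : E n → ℝ) :
    ¬ IsDrift μ (linearMap A B) V := by
  intro hV
  have := hw.isProbabilityMeasure
  obtain ⟨C, hC, hdrift⟩ := hV.drift
  obtain ⟨R, hR⟩ := hC.isBounded.exists_norm_le
  obtain ⟨x₀, F, hF, hFω⟩ := exists_escape hA B hw R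
  -- Freezing the dynamics on `C` makes the drift inequality global; on `F` the trajectory never
  -- meets `C`, so nothing changes there.
  let f : E n → E m → E n := fun x v => if x ∈ C then x else linearMap A B x v
  have hf : Measurable (Function.uncurry f) :=
    Measurable.ite (measurable_fst hC.measurableSet) measurable_fst (measurable_linearMap A B)
  have heq : ∀ ω ∈ F, ∀ k, trajectory f w x₀ k ω = trajectory (linearMap A B) w x₀ k ω := by
    intro ω hω k
    induction k with
    | zero => rfl
    | succ k ih =>
      have hk : trajectory (linearMap A B) w x₀ k ω ∉ C := fun h =>
        ((hFω ω hω).1 k).not_ge (hR _ h)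
      rw [trajectory, ih, trajectory]
      exact if_neg hk
  have hsuper : ∀ x, ∫⁻ v, ENNReal.ofReal (V (f x v)) ∂μ ≤ ENNReal.ofReal (V x) := by
    intro x
    by_cases hx : x ∈ C
    · simp [f, hx]
    · obtain ⟨hi, hle⟩ := hdrift x hx
      simp only [f, hx, if_false]
      rw [← ofReal_integral_eq_lintegral_ofReal hi (.of_forall fun _ => hV.nonneg _)]
      exact ENNReal.ofReal_le_ofReal (sub_nonpos.1 hle)
  have hbound := lintegral_trajectory_le hf hw hV.measurable.ennreal_ofReal hsuper x₀
  have hXm : ∀ k, Measurable fun ω => ENNReal.ofReal (V (trajectory f w x₀ k ω)) := fun k =>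
    (hV.measurable.comp (measurable_trajectory hf hw.measurable x₀ k)).ennreal_ofReal
  -- By Fatou the lower limit of `V` along the frozen trajectory is almost surely finite, whereas on
  -- `F` it is infinite by coercivity.
  have hfatou : ∫⁻ ω, liminf (fun k => ENNReal.ofReal (V (trajectory f w x₀ k ω))) atTop ∂P
      ≤ ENNReal.ofReal (V x₀) :=
    (lintegral_liminf_le hXm).trans (liminf_le_of_le (by isBoundedDefault)
      fun b hb => by
        obtain ⟨k, hk⟩ := hb.exists
        exact hk.trans (hbound k))
  have hae := ae_lt_top (Measurable.liminf hXm) (hfatou.trans_lt ENNReal.ofReal_lt_top).ne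
  refine hF (measure_mono_null (fun ω hω => ?_) hae)
  have h1 : Tendsto (fun k => ENNReal.ofReal (V (trajectory f w x₀ k ω))) atTop (nhds ⊤) := by
    refine ENNReal.tendsto_ofReal_atTop.comp (hV.coercive.comp (tendsto_comap_iff.2 ?_))
    refine (hFω ω hω).2.congr fun k => ?_
    rw [Function.comp_apply, heq ω hω k]
  simp [h1.liminf_eq]

end Unstable

end StochReach

theorem mainTheorem2 {Ω : Type*} [MeasurableSpace Ω] (P : Measure Ω) [IsProbabilityMeasure P]
    (n m : ℕ) (A : Matrix (Fin n) (Fin n) ℝ) (B : Matrix (Fin n) (Fin m) ℝ)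
    (μ : Measure (StochReach.E m)) (w : ℕ → Ω → StochReach.E m)
    (hw : StochReach.IsNoise P μ w) :
    (StochReach.rho A < 1 →
      (∀ G : Set (StochReach.E n), IsOpen G → Bornology.IsBounded G → 0 ∈ G →
        StochReach.AlmostSurelyReaches P (StochReach.linearMap A B) w G) ∧
      ∃ Q : Matrix (Fin n) (Fin n) ℝ, Q.PosDef ∧ A.transpose * Q * A = Q - 1 ∧
        StochReach.IsDrift μ (StochReach.linearMap A B) (StochReach.quadForm Q) ∧
        ∀ G : Set (StochReach.E n), IsOpen G → Bornology.IsBounded G → 0 ∈ G →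
          ∃ b : ℝ, 0 < b ∧
            StochReach.IsVariant μ (StochReach.linearMap A B) (StochReach.quadForm Q)
              (fun x => StochReach.quadForm Q x - b) ∧
            {x | StochReach.quadForm Q x - b ≤ 0} ⊆ G) ∧
    (1 < StochReach.rho A →
      (∀ G : Set (StochReach.E n), IsOpen G → Bornology.IsBounded G →
        ¬ StochReach.AlmostSurelyReaches P (StochReach.linearMap A B) w G) ∧
      ¬ ∃ V : StochReach.E n → ℝ, StochReach.IsDrift μ (StochReach.linearMap A B) V) := by
  refine ⟨fun hA => ⟨fun G hG _ h0 => StochReach.almostSurelyReaches_of_rho_lt_one hA B hw hG h0,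
    ?_⟩, fun hA => ⟨fun G hGo hG => StochReach.not_almostSurelyReaches_of_one_lt_rho hA B hw hGo hG,
    fun ⟨V, hV⟩ => StochReach.not_isDrift_of_one_lt_rho hA B hw V hV⟩⟩
  obtain ⟨Q, hQ, hl, hle⟩ := StochReach.exists_lyapunov A hA
  refine ⟨Q, hQ, hl, StochReach.isDrift_quadForm B hw hl hle, fun G hG _ h0 => ?_⟩
  obtain ⟨s, hs, hsG⟩ := Metric.isOpen_iff.1 hG 0 h0
  -- Since `‖x‖ ^ 2 ≤ quadForm Q x`, this level confines the sublevel set to the ball of radius `s`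
  -- inside `G`.
  refine ⟨(s / 2) ^ 2, by positivity, StochReach.isVariant_quadForm B hw hl hle (by positivity),
    fun x hx => hsG ?_⟩
  have h1 : ‖x‖ ^ 2 ≤ (s / 2) ^ 2 := (hle x).trans (sub_nonpos.1 hx)
  rw [mem_ball_zero_iff]
  exact ((sq_le_sq₀ (norm_nonneg x) (by positivity)).1 h1).trans_lt (half_lt_self hs)
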